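/- All rings are commutative with unit; a local ring is a (not necessarily Noetherian) ring with exactly one maximal ideal. For a ring $R$, the content ideal $c(p)$ of $p\in R[X]$ is the ideal of $R$ generated by the coefficients of $p$. The Nagata ring is $R(X):=R[X]_{\Sigma}$ with $\Sigma=\{p\in R[X] : c(p)=R\}$, and $I(X):=I\,R(X)$ for an ideal $I$ of $R$; if $R$ is local, so is $R(X)$. An element $t$ of a local ring $A$ is a strong divisor of $A$ if $0:At=0$ (that is, $t$ is regular) and the ideal $At$ is distributive, i.e. $At+(J\cap K)=(At+J)\cap(At+K)$ for all ideals $J,K$ of $A$. For $x,y\in A$ we write $x\simeq y$ (in $A$) if $\mathrm D(x)=\mathrm D(y)$ in $\mathrm{Spec}(A)$, equivalently $\sqrt{Ax}=\sqrt{Ay}$. For an ideal $I$ of $R$, $\mathrm D(I)$ is the set of primes of $R$ that do not contain $I$. **Theorem.** Let $R$ be a local ring, let $p(X)=\sum_{i=0}^n a_iX^i\in R[X]$ be such that $p(X)/1$ is a non-unit strong divisor of $R(X)$, and let $I=c(p)$ be the content ideal of $p(X)$. Then: 1. there is a strong divisor $\rho$ of $R$ such that $I=R\rho$ and $p(X)/1\simeq\rho$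 in $R(X)$; 2. $I(X)=R(X)\,p(X)/1$; 3. for each $i$, if $p(X)/1\in R(X)a_i$, then $I=Ra_i$; 4. the image of the natural map $\mathrm{Spec}\bigl(R(X)_{p(X)/1}\bigr)\to\mathrm{Spec}(R)$ is $\mathrm D(I)$. -/

import Mathlib

/-- The multiplicatively closed subset `Σ_R` of `R[X]` of all polynomials whose content ideal
is the whole ring `R`. -/
noncomputable def unitContentSubmonoid (R : Type*) [CommRing R] :
    Submonoid (Polynomial R) where
  carrier := {p | p.contentIdeal = ⊤}
  one_mem' := Polynomial.contentIdeal_one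
  mul_mem' hp hq := Polynomial.contentIdeal_mul_eq_top_of_contentIdeal_eq_top hp hq

/-- The Nagata ring `R(X)`: the localization of `R[X]` at the polynomials of content `R`. -/
abbrev NagataRing (R : Type*) [CommRing R] : Type _ :=
  Localization (unitContentSubmonoid R)

/-- An ideal `I` is distributive if `I + (J ∩ K) = (I + J) ∩ (I + K)` for all ideals `J`, `K`. -/
def IsDistributiveIdeal {A : Type*} [CommRing A] (I : Ideal A) : Prop :=
  ∀ J K : Ideal A, I ⊔ (J ⊓ K) = (I ⊔ J) ⊓ (I ⊔ K)

/-- An ideal (of a local ring) is a strong divisor if it is distributive and `0 : I = 0`. -/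
def IsStrongDivisorIdeal {A : Type*} [CommRing A] (I : Ideal A) : Prop :=
  IsDistributiveIdeal I ∧ Submodule.annihilator I = ⊥

/-- An element `t` (of a local ring `A`) is a strong divisor if the ideal `A t` is one. -/
def IsStrongDivisor {A : Type*} [CommRing A] (t : A) : Prop :=
  IsStrongDivisorIdeal (Ideal.span {t})

/-- Two elements are equivalent, `x ≃ y`, if `D(x) = D(y)` in the prime spectrum. -/
def SpecEquivalent {A : Type*} [CommRing A] (x y : A) : Prop :=
  PrimeSpectrum.basicOpen x = PrimeSpectrum.basicOpen y

/-- The open subset `D(I)` of `Spec A`: the primes that do not contain `I`. -/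
def openOfIdeal {A : Type*} [CommRing A] (I : Ideal A) : Set (PrimeSpectrum A) :=
  {P | ¬ I ≤ P.asIdeal}

/-- The spectral image of an `A`-algebra `B`: the image of `Spec B → Spec A`. -/
def spectralImage (A : Type*) [CommRing A] (B : Type*) [CommRing B] [Algebra A B] :
    Set (PrimeSpectrum A) :=
  Set.range (PrimeSpectrum.comap (algebraMap A B))

/-! In the local ring `R(X)`, a strong divisor is a regular element comparable with every element
for divisibility. So `p` is comparable with each coefficient `a_i`; if `a_i ∣ p`, regularity makes
the quotient a unit (`dvd_algebraMap_coeff`), so `p ∣ a_i` in every case. As `p = ∑ a_i X^i`, a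
Nakayama argument (`exists_dvd_of_eq_sum`) gives one `a_i` dividing `p`; this is `ρ`. Divisibility
descends to `R` because `f ∈ J R(X)` iff `c(f) ⊆ J` (`algebraMap_mem_map_iff`). -/

open Polynomial in
theorem contentIdeal_le_iff {R : Type*} [CommRing R] {f : R[X]} {J : Ideal R} :
    f.contentIdeal ≤ J ↔ ∀ n, f.coeff n ∈ J := by
  refine ⟨fun h n => h (f.coeff_mem_contentIdeal n), fun h => ?_⟩
  rw [contentIdeal_def, Ideal.span_le]
  intro r hr
  obtain ⟨n, -, rfl⟩ := mem_coeffs_iff.mp hr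
  exact h n

open Polynomial in
theorem contentIdeal_le_iff_map_mk_eq_zero {R : Type*} [CommRing R] {f : R[X]} {J : Ideal R} :
    f.contentIdeal ≤ J ↔ f.map (Ideal.Quotient.mk J) = 0 := by
  simp only [contentIdeal_le_iff, Polynomial.ext_iff, coeff_map, coeff_zero,
    Ideal.Quotient.eq_zero_iff_mem]

-- By McCoy, a zero divisor is killed by a nonzero constant, which would then annihilate the whole
-- content.
open Polynomial in
theorem mem_nonZeroDivisors_of_contentIdeal_eq_top {R : Type*} [CommRing R] {g : R[X]}
    (hg : g.contentIdeal = ⊤) : g ∈ nonZeroDivisors R[X] := by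
  by_contra h
  obtain ⟨a, ha, hag⟩ := Polynomial.notMem_nonZeroDivisors_iff.mp h
  refine ha ?_
  have hle : g.contentIdeal ≤ Submodule.annihilator (Ideal.span {a}) := by
    refine contentIdeal_le_iff.mpr fun n => ?_
    rw [Submodule.mem_annihilator_span_singleton, smul_eq_mul, mul_comm, ← smul_eq_mul,
      ← coeff_smul, hag, coeff_zero]
  have h1 : (1 : R) ∈ Submodule.annihilator (Ideal.span {a}) := hle (hg ▸ Submodule.mem_top)
  simpa [Submodule.mem_annihilator_span_singleton] using h1

-- Modulo `J`, `g` still has unit content, so it is regular and can be cancelled.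
open Polynomial in
theorem contentIdeal_le_of_contentIdeal_mul_le {R : Type*} [CommRing R] {f g : R[X]}
    {J : Ideal R} (hg : g.contentIdeal = ⊤) (h : (f * g).contentIdeal ≤ J) :
    f.contentIdeal ≤ J := by
  rw [contentIdeal_le_iff_map_mk_eq_zero, Polynomial.map_mul] at h
  rw [contentIdeal_le_iff_map_mk_eq_zero]
  have hg' : (g.map (Ideal.Quotient.mk J)).contentIdeal = ⊤ := by
    rw [contentIdeal_map_eq_map_contentIdeal, hg, Ideal.map_top]
  exact (mul_right_mem_nonZeroDivisors_eq_zero_iff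
    (mem_nonZeroDivisors_of_contentIdeal_eq_top hg')).mp h

namespace NagataRing

variable {R : Type*} [CommRing R]

theorem algebraMap_mem_map_iff {f : Polynomial R} {J : Ideal R} :
    algebraMap (Polynomial R) (NagataRing R) f ∈ J.map (algebraMap R (NagataRing R)) ↔
      f.contentIdeal ≤ J := by
  rw [IsScalarTower.algebraMap_eq R (Polynomial R) (NagataRing R), ← Ideal.map_map,
    IsLocalization.mem_map_algebraMap_iff (unitContentSubmonoid R)]
  constructor
  · rintro ⟨⟨⟨u, hu⟩, s⟩, hs⟩
    rw [← map_mul, IsLocalization.eq_iff_exists (unitContentSubmonoid R)] at hs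
    obtain ⟨c, hc⟩ := hs
    refine contentIdeal_le_of_contentIdeal_mul_le s.2
      (contentIdeal_le_of_contentIdeal_mul_le c.2 ?_)
    rw [mul_comm, hc, contentIdeal_le_iff, ← Ideal.mem_map_C_iff]
    exact Ideal.mul_mem_left _ _ hu
  · intro h
    exact ⟨⟨⟨f, Ideal.mem_map_C_iff.mpr (contentIdeal_le_iff.mp h)⟩, 1⟩, by simp⟩

theorem comap_map_algebraMap (J : Ideal R) :
    (J.map (algebraMap R (NagataRing R))).comap (algebraMap R (NagataRing R)) = J := by
  ext r
  rw [Ideal.mem_comap, IsScalarTower.algebraMap_apply R (Polynomial R) (NagataRing R),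
    algebraMap_mem_map_iff, Polynomial.algebraMap_eq, Polynomial.contentIdeal_C,
    Ideal.span_singleton_le_iff_mem]

theorem algebraMap_dvd_algebraMap_iff {a : R} {f : Polynomial R} :
    algebraMap R (NagataRing R) a ∣ algebraMap (Polynomial R) (NagataRing R) f ↔
      f.contentIdeal ≤ Ideal.span {a} := by
  rw [← algebraMap_mem_map_iff, Ideal.map_span, Set.image_singleton, Ideal.mem_span_singleton]

theorem algebraMap_dvd_algebraMap_base_iff {a b : R} :
    algebraMap R (NagataRing R) a ∣ algebraMap R (NagataRing R) b ↔ a ∣ b := by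
  rw [IsScalarTower.algebraMap_apply R (Polynomial R) (NagataRing R) b,
    algebraMap_dvd_algebraMap_iff, Polynomial.algebraMap_eq, Polynomial.contentIdeal_C,
    Ideal.span_singleton_le_span_singleton]

theorem algebraMap_injective : Function.Injective (algebraMap R (NagataRing R)) := by
  rw [injective_iff_map_eq_zero]
  intro a ha
  rw [← zero_dvd_iff, ← algebraMap_dvd_algebraMap_base_iff, map_zero, ha]

/-- Over a local ring, the polynomials of unit content form the complement of a prime ideal. -/
theorem unitContentSubmonoid_eq_primeCompl [IsLocalRing R] :
    unitContentSubmonoid R =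
      ((IsLocalRing.maximalIdeal R).map (Polynomial.C : R →+* Polynomial R)).primeCompl := by
  ext f
  change f.contentIdeal = ⊤ ↔ f ∉ _
  rw [SetLike.mem_coe, Ideal.mem_map_C_iff, ← contentIdeal_le_iff]
  refine ⟨fun h hle => Ideal.IsPrime.ne_top' (top_le_iff.mp (h ▸ hle)), fun h => ?_⟩
  by_contra hne
  exact h (IsLocalRing.le_maximalIdeal hne)

instance isLocalRing [IsLocalRing R] : IsLocalRing (NagataRing R) := by
  have : IsLocalization.AtPrime (NagataRing R)
      ((IsLocalRing.maximalIdeal R).map (Polynomial.C : R →+* Polynomial R)) := by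
    unfold IsLocalization.AtPrime
    rw [← unitContentSubmonoid_eq_primeCompl]
    infer_instance
  exact IsLocalization.AtPrime.isLocalRing (NagataRing R)
    ((IsLocalRing.maximalIdeal R).map (Polynomial.C : R →+* Polynomial R))

theorem algebraMap_eq_sum (p : Polynomial R) :
    algebraMap (Polynomial R) (NagataRing R) p =
      ∑ i ∈ p.support, algebraMap R (NagataRing R) (p.coeff i) *
        algebraMap (Polynomial R) (NagataRing R) Polynomial.X ^ i := by
  conv_lhs => rw [p.as_sum_support_C_mul_X_pow]
  simp only [map_sum, map_mul, map_pow,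
    IsScalarTower.algebraMap_apply R (Polynomial R) (NagataRing R), Polynomial.algebraMap_eq]

end NagataRing

/-- In a local ring, a principal ideal is distributive iff its generator is comparable to every
element for divisibility. -/
theorem isDistributiveIdeal_span_singleton_iff {A : Type*} [CommRing A] [IsLocalRing A] {t : A} :
    IsDistributiveIdeal (Ideal.span {t}) ↔ ∀ x, x ∣ t ∨ t ∣ x := by
  constructor
  · intro h x
    -- Distributivity is tested on `Ax` and `A(t - x)`: `x` lies in both sums with `At`.
    have hx : x ∈ Ideal.span {t} ⊔ Ideal.span {x} ⊓ Ideal.span {t - x} := by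
      rw [h]
      refine ⟨Ideal.mem_sup_right (Ideal.mem_span_singleton_self x), ?_⟩
      have := sub_mem (Ideal.mem_sup_left (Ideal.mem_span_singleton_self t))
        (Ideal.mem_sup_right (Ideal.mem_span_singleton_self (t - x)) :
          t - x ∈ Ideal.span {t} ⊔ Ideal.span {t - x})
      rwa [sub_sub_cancel] at this
    obtain ⟨y, hy, z, ⟨hz, hz'⟩, hyz⟩ := Submodule.mem_sup.mp hx
    obtain ⟨a, rfl⟩ := Ideal.mem_span_singleton.mp hy
    obtain ⟨b, rfl⟩ := Ideal.mem_span_singleton.mp hz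
    obtain ⟨c, hc⟩ := Ideal.mem_span_singleton.mp hz'
    -- Now `(1 - b)x = ta` and `(b + c)x = ct`. Since `(1 - b) + (b + c) - c = 1`, one of these
    -- three is a unit.
    by_cases hb : IsUnit (1 - b)
    · right
      exact hb.dvd_mul_right.mp ⟨a, by linear_combination -hyz⟩
    by_cases hc' : IsUnit c
    · left
      exact hc'.dvd_mul_right.mp ⟨b + c, by linear_combination -hc⟩
    · right
      have hbc : IsUnit (b + c) := by
        by_contra hbc
        refine (IsLocalRing.maximalIdeal A).one_notMem ?_
        have := Ideal.sub_mem _ (Ideal.add_mem _ (show 1 - b ∈ IsLocalRing.maximalIdeal A from hb)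
          (show b + c ∈ IsLocalRing.maximalIdeal A from hbc))
          (show c ∈ IsLocalRing.maximalIdeal A from hc')
        rwa [show 1 - b + (b + c) - c = 1 by ring] at this
      exact hbc.dvd_mul_right.mp ⟨c, by linear_combination hc⟩
  · intro h J K
    have key : ∀ L : Ideal A, Ideal.span {t} ≤ L ∨ L ≤ Ideal.span {t} := by
      intro L
      by_contra! hL
      obtain ⟨x, hxL, hxt⟩ := SetLike.not_le_iff_exists.mp hL.2
      rw [Ideal.span_singleton_le_iff_mem] at hL
      rw [Ideal.mem_span_singleton] at hxt
      exact hL.1 (L.mem_of_dvd ((h x).resolve_right hxt) hxL)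
    rcases key J with hJ | hJ
    · rcases key K with hK | hK
      · rw [sup_eq_right.mpr hJ, sup_eq_right.mpr hK, sup_eq_right.mpr (le_inf hJ hK)]
      · rw [sup_eq_left.mpr hK, sup_eq_left.mpr (inf_le_right.trans hK),
          inf_eq_right.mpr le_sup_left]
    · rw [sup_eq_left.mpr hJ, sup_eq_left.mpr (inf_le_left.trans hJ), inf_eq_left.mpr le_sup_left]

theorem isStrongDivisor_iff {A : Type*} [CommRing A] [IsLocalRing A] {t : A} :
    IsStrongDivisor t ↔ (∀ x, x ∣ t ∨ t ∣ x) ∧ ∀ x, x * t = 0 → x = 0 := by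
  rw [IsStrongDivisor, IsStrongDivisorIdeal, isDistributiveIdeal_span_singleton_iff,
    Submodule.eq_bot_iff]
  simp only [Submodule.mem_annihilator_span_singleton, smul_eq_mul]

/-- Nakayama-type statement: in a local ring, a regular element that divides all terms of a
sum it equals is divisible by one of the terms. -/
theorem exists_dvd_of_eq_sum {A ι : Type*} [CommRing A] [IsLocalRing A] {t : A}
    (ht : ∀ x, x * t = 0 → x = 0) (s : Finset ι) (a b : ι → A)
    (hdvd : ∀ i ∈ s, t ∣ a i) (hsum : t = ∑ i ∈ s, a i * b i) : ∃ i ∈ s, a i ∣ t := by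
  choose! c hc using hdvd
  -- Cancelling `t` leaves a sum equal to `1`, so some cofactor `c i` is a unit.
  have h1 : ∑ i ∈ s, c i * b i = 1 := by
    rw [← sub_eq_zero]
    refine ht _ ?_
    have : t = t * ∑ i ∈ s, c i * b i := by
      rw [Finset.mul_sum]
      conv_lhs => rw [hsum]
      exact Finset.sum_congr rfl fun i hi => by rw [hc i hi, mul_assoc]
    linear_combination -this
  by_contra! hn
  refine (IsLocalRing.maximalIdeal A).one_notMem ?_
  rw [← h1]
  refine Ideal.sum_mem _ fun i hi => Ideal.mul_mem_right _ _ ?_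
  rw [IsLocalRing.mem_maximalIdeal, mem_nonunits_iff]
  intro hu
  exact hn i hi (by rw [hc i hi]; exact hu.mul_right_dvd.mpr dvd_rfl)

theorem SpecEquivalent.of_dvd_dvd {A : Type*} [CommRing A] {x y : A} (hxy : x ∣ y) (hyx : y ∣ x) :
    SpecEquivalent x y := by
  ext P
  exact not_congr ⟨P.asIdeal.mem_of_dvd hxy, P.asIdeal.mem_of_dvd hyx⟩

namespace NagataRing

variable {R : Type*} [CommRing R] {p : Polynomial R}

theorem contentIdeal_eq_span_coeff {i : ℕ}
    (h : algebraMap R (NagataRing R) (p.coeff i) ∣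
      algebraMap (Polynomial R) (NagataRing R) p) :
    p.contentIdeal = Ideal.span {p.coeff i} :=
  le_antisymm (algebraMap_dvd_algebraMap_iff.mp h)
    ((Ideal.span_singleton_le_iff_mem _).mpr (p.coeff_mem_contentIdeal i))

theorem dvd_algebraMap_coeff
    (hreg : ∀ x, x * algebraMap (Polynomial R) (NagataRing R) p = 0 → x = 0) {i : ℕ}
    (h : algebraMap R (NagataRing R) (p.coeff i) ∣
      algebraMap (Polynomial R) (NagataRing R) p) :
    algebraMap (Polynomial R) (NagataRing R) p ∣ algebraMap R (NagataRing R) (p.coeff i) := by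
  have hI := contentIdeal_eq_span_coeff h
  have hdvd : Polynomial.C (p.coeff i) ∣ p := by
    rw [Polynomial.C_dvd_iff_dvd_coeff]
    intro n
    rw [← Ideal.mem_span_singleton, ← hI]
    exact p.coeff_mem_contentIdeal n
  obtain ⟨q, hq⟩ := hdvd
  have hcoeff : p.coeff i = p.coeff i * q.coeff i := by
    conv_lhs => rw [hq, Polynomial.coeff_C_mul]
  have hpq : algebraMap (Polynomial R) (NagataRing R) p =
      algebraMap R (NagataRing R) (p.coeff i) * algebraMap (Polynomial R) (NagataRing R) q := by
    conv_lhs => rw [hq, map_mul]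
    rw [IsScalarTower.algebraMap_apply R (Polynomial R) (NagataRing R), Polynomial.algebraMap_eq]
  -- `1 - q_i` kills `a_i`, hence `p`, which is regular. The coefficient `1` then gives `q` unit
  -- content.
  have hqi : q.coeff i = 1 := by
    refine (sub_eq_zero.mp (algebraMap_injective ?_)).symm
    rw [map_zero]
    refine hreg _ ?_
    rw [hpq, ← mul_assoc, ← map_mul, show (1 - q.coeff i) * p.coeff i = 0 by
      linear_combination hcoeff, map_zero, zero_mul]
  have hqu : IsUnit (algebraMap (Polynomial R) (NagataRing R) q) :=
    IsLocalization.map_units (NagataRing R) (⟨q, (Ideal.eq_top_iff_one _).mpr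
      (hqi ▸ q.coeff_mem_contentIdeal i)⟩ : unitContentSubmonoid R)
  rw [hpq]
  exact hqu.mul_right_dvd.mpr dvd_rfl

theorem isStrongDivisor_of_algebraMap [IsLocalRing R] {a : R}
    (h : IsStrongDivisor (algebraMap R (NagataRing R) a)) : IsStrongDivisor a := by
  rw [isStrongDivisor_iff] at h ⊢
  refine ⟨fun x => ?_, fun x hx => algebraMap_injective ?_⟩
  · simpa only [algebraMap_dvd_algebraMap_base_iff] using h.1 (algebraMap R (NagataRing R) x)
  · rw [map_zero]
    exact h.2 _ (by rw [← map_mul, hx, map_zero])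

end NagataRing

open NagataRing in
theorem mainTheorem8 {R : Type*} [CommRing R] [IsLocalRing R] (p : Polynomial R)
    (hp : IsStrongDivisor (algebraMap (Polynomial R) (NagataRing R) p))
    (hpu : ¬ IsUnit (algebraMap (Polynomial R) (NagataRing R) p)) :
    (∃ ρ : R, IsStrongDivisor ρ ∧ p.contentIdeal = Ideal.span {ρ} ∧
      SpecEquivalent (algebraMap (Polynomial R) (NagataRing R) p)
        (algebraMap R (NagataRing R) ρ)) ∧
    p.contentIdeal.map (algebraMap R (NagataRing R)) =
      Ideal.span {algebraMap (Polynomial R) (NagataRing R) p} ∧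
    (∀ i : ℕ,
      algebraMap (Polynomial R) (NagataRing R) p ∈
        Ideal.span {algebraMap R (NagataRing R) (p.coeff i)} →
      p.contentIdeal = Ideal.span {p.coeff i}) ∧
    spectralImage R (Localization.Away (algebraMap (Polynomial R) (NagataRing R) p)) =
      openOfIdeal p.contentIdeal := by
  have hp' := isStrongDivisor_iff.mp hp
  have hcoeff (i : ℕ) : algebraMap (Polynomial R) (NagataRing R) p ∣
      algebraMap R (NagataRing R) (p.coeff i) :=
    (hp'.1 _).elim (dvd_algebraMap_coeff hp'.2) id
  obtain ⟨i, -, hi⟩ := exists_dvd_of_eq_sum hp'.2 p.support _ _ (fun i _ => hcoeff i)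
    (algebraMap_eq_sum p)
  have hI := contentIdeal_eq_span_coeff hi
  have hspan : Ideal.span {algebraMap R (NagataRing R) (p.coeff i)} =
      Ideal.span {algebraMap (Polynomial R) (NagataRing R) p} :=
    le_antisymm (Ideal.span_singleton_le_span_singleton.mpr (hcoeff i))
      (Ideal.span_singleton_le_span_singleton.mpr hi)
  have hmap : p.contentIdeal.map (algebraMap R (NagataRing R)) =
      Ideal.span {algebraMap (Polynomial R) (NagataRing R) p} := by
    rw [hI, Ideal.map_span, Set.image_singleton, hspan]
  refine ⟨⟨p.coeff i, isStrongDivisor_of_algebraMap ?_, hI,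
    .of_dvd_dvd (hcoeff i) hi⟩, hmap, fun j hj =>
      contentIdeal_eq_span_coeff (Ideal.mem_span_singleton.mp hj), ?_⟩
  · rw [IsStrongDivisor, hspan]
    exact hp
  · rw [spectralImage, IsScalarTower.algebraMap_eq R (NagataRing R), PrimeSpectrum.comap_comp,
      Set.range_comp, PrimeSpectrum.localization_away_comap_range _
        (algebraMap (Polynomial R) (NagataRing R) p)]
    -- As `p` generates `I(X)`, whether `Q` contains `p` depends only on `Q ∩ R`.
    have hmem (Q : PrimeSpectrum (NagataRing R)) :
        algebraMap (Polynomial R) (NagataRing R) p ∈ Q.asIdeal ↔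
          p.contentIdeal ≤ (Q.comap (algebraMap R (NagataRing R))).asIdeal := by
      rw [PrimeSpectrum.comap_asIdeal, ← Ideal.map_le_iff_le_comap, hmap,
        Ideal.span_singleton_le_iff_mem]
    ext P
    constructor
    · rintro ⟨Q, hQ, rfl⟩
      exact fun hle => hQ ((hmem Q).mpr hle)
    · intro hP
      -- Every prime of `R` lifts, since extending it to `R(X)` and contracting gives it back.
      obtain ⟨Q, rfl⟩ := (PrimeSpectrum.mem_range_comap_iff (algebraMap R (NagataRing R))).mpr
        (comap_map_algebraMap P.asIdeal)
      exact ⟨Q, fun hQ => hP ((hmem Q).mp hQ), rfl⟩
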